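/- For $q\ge 1$, an $\mathsf{AC}^0[q]$ circuit on $n$ inputs is a finite acyclic circuit whose gates are AND, OR and $\mathrm{MOD}_q$ gates of unbounded fan-in (parallel wires are allowed) and NOT gates, where a $\mathrm{MOD}_q$ gate outputs $1$ if and only if the number of ones among its inputs is divisible by $q$. Its size is the number of gates plus the number of wires. Its depth is the largest number of gates on a path to the output, where NOT gates are not counted; "of depth $D$" means of depth at most $D$. The function $\mathrm{MOD}_m:\{0,1\}^n\to\{0,1\}$ is $1$ on $\mathbf x$ if and only if $m$ divides $\sum_i x_i$. Theorem. There are absolute constants $K$ and $k$ with the following property. Let $d$ be a positive multiple of $6$, let $n\ge 1$ be an integer, and let $\alpha\in(0,1]$ be real. Set \[ s := \left\lceil \frac{3\alpha\log_2 n}{7}\right\rceil,\quad t := \left\lceil \frac{2\alpha\log_3 n}{7}\right\rceil,\quad u := \left\lceil \frac{2\alpha\log_7 n}{7}\right\rceil,\quad m := 2^s\,3^t\,7^u . \] Then there is an $\mathsf{AC}^0[42]$ circuit of depth $d+1$ and size at most \[ 2^{\,K\, n^{6\alpha/(7d)}\,(\log_2(n+1))^{k}} \;=\; 2^{\widetilde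 O(n^{6\alpha/(7d)})} \] that computes the function $\mathrm{MOD}_m$ on $n$ inputs and whose output gate is an AND gate. -/

import Mathlib

/-- The gate types of an `AC⁰[q]` circuit: unbounded fan-in AND, OR and `MOD_q`, and NOT. -/
inductive GateOp where
  | and
  | or
  | mod
  | not
  deriving DecidableEq

/-- The Boolean function of a gate, applied to the list of its input bits. A `MOD_q` gate outputs
`1` iff `q` divides the number of ones among its inputs. NOT is only used on lists of length one. -/
def GateOp.apply (q : ℕ) : GateOp → List Bool → Bool
  | .and, l => l.all fun b => b
  | .or, l => l.any fun b => b
  | .mod, l => decide (q ∣ l.count true)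
  | .not, l => l.all fun b => !b

/-- An `AC⁰[q]` circuit on `n` inputs: a finite acyclic graph of gates with a designated output
gate. Each gate has a list of incoming wires (so wires may be repeated), each of them coming from
an input variable or from another gate; NOT gates have exactly one incoming wire. -/
structure ACCircuit (q n : ℕ) where
  Gate : Type
  [fintypeGate : Fintype Gate]
  op : Gate → GateOp
  wires : Gate → List (Fin n ⊕ Gate)
  not_arity : ∀ g, op g = GateOp.not → (wires g).length = 1
  acyclic : WellFounded fun h g : Gate => Sum.inr h ∈ wires g
  output : Gate

namespace ACCircuit

attribute [instance] ACCircuit.fintypeGate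

variable {q n : ℕ}

/-- The bit computed by each gate on the input `x`. -/
def value (c : ACCircuit q n) (x : Fin n → Bool) : c.Gate → Bool :=
  c.acyclic.fix fun g ih =>
    (c.op g).apply q ((c.wires g).attach.map fun w =>
      match w with
      | ⟨Sum.inl i, _⟩ => x i
      | ⟨Sum.inr h, hw⟩ => ih h hw)

/-- The depth of each gate: the largest number of gates other than NOT gates on a directed path
ending in it. Input variables have depth `0`, and NOT gates do not count. -/
def gateDepth (c : ACCircuit q n) : c.Gate → ℕ :=
  c.acyclic.fix fun g ih =>
    (if c.op g = GateOp.not then 0 else 1) +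
      ((c.wires g).attach.map fun w =>
        match w with
        | ⟨Sum.inl _, _⟩ => 0
        | ⟨Sum.inr h, hw⟩ => ih h hw).foldr max 0

theorem value_eq (c : ACCircuit q n) (x : Fin n → Bool) (g : c.Gate) :
    c.value x g = (c.op g).apply q ((c.wires g).map (Sum.elim x (c.value x))) := by
  unfold value
  rw [WellFounded.fix_eq]
  congr 1
  conv_rhs => rw [← List.attach_map_subtype_val (c.wires g), List.map_map]
  apply List.map_congr_left
  rintro ⟨w | w, hw⟩ _ <;> rfl

theorem gateDepth_eq (c : ACCircuit q n) (g : c.Gate) :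
    c.gateDepth g = (if c.op g = GateOp.not then 0 else 1) +
      ((c.wires g).map (Sum.elim (fun _ => 0) c.gateDepth)).foldr max 0 := by
  unfold gateDepth
  rw [WellFounded.fix_eq]
  congr 2
  conv_rhs => rw [← List.attach_map_subtype_val (c.wires g), List.map_map]
  apply List.map_congr_left
  rintro ⟨w | w, hw⟩ _ <;> rfl

/-- The depth of the circuit. -/
def depth (c : ACCircuit q n) : ℕ := c.gateDepth c.output

/-- The size of the circuit: the number of gates plus the number of wires. -/
def size (c : ACCircuit q n) : ℕ := Fintype.card c.Gate + ∑ g, (c.wires g).length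

/-- The circuit computes the Boolean function `f`. -/
def Computes (c : ACCircuit q n) (f : (Fin n → Bool) → Bool) : Prop :=
  ∀ x, c.value x c.output = f x

end ACCircuit

/-- The Boolean function `MOD_m` on `n` inputs: it is `1` iff `m` divides the number of ones. -/
def modFunction (m n : ℕ) (x : Fin n → Bool) : Bool :=
  decide (m ∣ (Finset.univ.filter fun i => x i = true).card)

/-!
By the Chinese remainder theorem `MOD_m` is the conjunction of `MOD_{2^s}`, `MOD_{3^t}` and
`MOD_{7^u}`, and by Lucas' theorem `p ^ s ∣ N` holds if and only if `p ∣ C(N, p ^ j)` for all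
`j < s` (`prime_pow_dvd_iff_choose`). So one AND gate remains to be put on circuits of depth `d`
that decide `p ∣ C(N, p ^ j)`, where `N` is the number of ones of the input.

The number `C(N, D)` counts the increasing sequences of `D` ones, that is, the walks of length `D`
from a fixed vertex for the strictly triangular `stepMatrix`: it is a row sum of the `D`-th power of
this matrix (`sum_stepMatrix_pow`). A power `A ^ b` over `ZMod p` has entries that are polynomials of
degree `b` in the entries of `A`, with at most about `(n p) ^ b` terms (`isSparsePoly_pow`). If the
indicators `[A i k = v]` of nonzero residues `v` are available, then AND gates compute the monomials
and `MOD_p` gates, which are `MOD_42` gates with repeated wires, compute the indicators of the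
residues of the entries of `A ^ b`. Raising the matrix to the power `p ^ r` thus costs two layers and
a factor `n ^ O(p ^ r)` in size. With `e = d / 2` rounds and `r` about `j / e`, the `p ^ j`-th power
is reached in depth `d` and size `n ^ O(p ^ (s / e) log n)` (`exists_isWire_dvd_choose`), and
`p ^ (s / e)` is at most a constant times `n ^ (6 α / (7 d))` for each of the three primes. No more
than `s ≤ O(log n)` rounds are ever used, so that the circuits may be trees and the constants do not
depend on `d`.
-/

/-! ### Stacking a gate on top of circuits -/

namespace ACCircuit

variable {q n : ℕ}

/-- The circuit consisting of disjoint copies of the circuits `c i` and one new output gate `op`,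
whose wires `w` come from input variables and from the outputs of the `c i`. It is reducible so that
its type of gates unfolds in rewriting. -/
abbrev stack {ι : Type} [Fintype ι] (op : GateOp) (hop : op ≠ GateOp.not)
    (c : ι → ACCircuit q n) (w : List (Fin n ⊕ ι)) : ACCircuit q n where
  Gate := Option (Σ i, (c i).Gate)
  fintypeGate := inferInstance
  op
    | none => op
    | some ⟨i, g⟩ => (c i).op g
  wires
    | none => w.map (Sum.map id fun i => some ⟨i, (c i).output⟩)
    | some ⟨i, g⟩ => ((c i).wires g).map (Sum.map id fun h => some ⟨i, h⟩)
  not_arity := by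
    rintro (_ | ⟨i, g⟩) h
    · exact absurd h hop
    · simpa using (c i).not_arity g h
  acyclic := by
    have key : ∀ (i : ι) (g : (c i).Gate), Acc (fun h g : Option (Σ i, (c i).Gate) => Sum.inr h ∈
        (match g with
          | none => w.map (Sum.map id fun i => some ⟨i, (c i).output⟩)
          | some ⟨i, g⟩ => ((c i).wires g).map (Sum.map id fun h => some ⟨i, h⟩) :
            List (Fin n ⊕ Option (Σ i, (c i).Gate)))) (some ⟨i, g⟩) := by
      intro i g
      induction g using (c i).acyclic.induction with
      | _ g ih =>
        refine Acc.intro _ fun y hy => ?_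
        obtain ⟨a | a, ha, e⟩ := List.mem_map.1 hy
        · simp at e
        · simp only [Sum.map_inr, Sum.inr.injEq] at e
          exact e ▸ ih a ha
    refine ⟨?_⟩
    rintro (_ | ⟨i, g⟩)
    · refine Acc.intro _ fun y hy => ?_
      obtain ⟨a | a, ha, e⟩ := List.mem_map.1 hy
      · simp at e
      · simp only [Sum.map_inr, Sum.inr.injEq] at e
        exact e ▸ key a _
    · exact key i g
  output := none

variable {ι : Type} [Fintype ι] {op : GateOp} (hop : op ≠ GateOp.not)
    (c : ι → ACCircuit q n) (w : List (Fin n ⊕ ι))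

theorem value_stack_some (x : Fin n → Bool) (i : ι) (g : (c i).Gate) :
    (stack op hop c w).value x (some ⟨i, g⟩) = (c i).value x g := by
  induction g using (c i).acyclic.induction with
  | _ g ih =>
    rw [value_eq, value_eq]
    change ((c i).op g).apply q ((((c i).wires g).map _).map _) = _
    rw [List.map_map]
    congr 1
    refine List.map_congr_left fun a ha => ?_
    rcases a with a | a
    · rfl
    · exact ih a ha

theorem value_stack_output (x : Fin n → Bool) :
    (stack op hop c w).value x (stack op hop c w).output =
      op.apply q (w.map (Sum.elim x fun i => (c i).value x (c i).output)) := by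
  rw [value_eq]
  change op.apply q ((w.map _).map _) = _
  rw [List.map_map]
  congr 1
  refine List.map_congr_left fun a _ => ?_
  rcases a with a | a
  · rfl
  · exact value_stack_some hop c w x a _

theorem gateDepth_stack_some (i : ι) (g : (c i).Gate) :
    (stack op hop c w).gateDepth (some ⟨i, g⟩) = (c i).gateDepth g := by
  induction g using (c i).acyclic.induction with
  | _ g ih =>
    rw [gateDepth_eq, gateDepth_eq]
    change (if (c i).op g = _ then 0 else 1) + ((((c i).wires g).map _).map _).foldr max 0 = _
    rw [List.map_map]
    congr 2
    refine List.map_congr_left fun a ha => ?_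
    rcases a with a | a
    · rfl
    · exact ih a ha

theorem foldr_max_le {l : List ℕ} {D : ℕ} (h : ∀ a ∈ l, a ≤ D) : l.foldr max 0 ≤ D := by
  induction l with
  | nil => simp
  | cons a l ih =>
    rw [List.foldr_cons]
    exact max_le (h a (by simp)) (ih fun b hb => h b (by simp [hb]))

theorem depth_stack_le {D : ℕ} (h : ∀ i, Sum.inr i ∈ w → (c i).depth ≤ D) :
    (stack op hop c w).depth ≤ D + 1 := by
  unfold depth
  rw [gateDepth_eq]
  change (if op = _ then 0 else 1) + ((w.map _).map _).foldr max 0 ≤ _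
  rw [if_neg hop, List.map_map, add_comm]
  refine Nat.add_le_add_right (foldr_max_le fun a ha => ?_) 1
  obtain ⟨b | b, hb, rfl⟩ := List.mem_map.1 ha
  · exact Nat.zero_le _
  · exact (gateDepth_stack_some hop c w b _).trans_le (h b hb)

theorem size_stack : (stack op hop c w).size = 1 + w.length + ∑ i, (c i).size := by
  have h1 : Fintype.card (stack op hop c w).Gate = (∑ i, Fintype.card (c i).Gate) + 1 := by
    change Fintype.card (Option (Σ i, (c i).Gate)) = _
    rw [Fintype.card_option, Fintype.card_sigma]
  have h2 : ∑ g, ((stack op hop c w).wires g).length =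
      w.length + ∑ i, ∑ g, ((c i).wires g).length := by
    change ∑ g : Option (Σ i, (c i).Gate), _ = _
    rw [Fintype.sum_option, Fintype.sum_sigma]
    congr 1
    · exact List.length_map _
    · exact Finset.sum_congr rfl fun i _ => Finset.sum_congr rfl fun g _ => List.length_map _
  unfold size
  rw [h1, h2, Finset.sum_add_distrib]
  ring

end ACCircuit

/-! ### Boolean functions of bounded circuit depth and size -/

/-- `IsWire q D S f`: the Boolean function `f` is available as a wire, being either an input
variable or the output of an `AC⁰[q]` circuit of depth at most `D` and size at most `S`. -/
def IsWire (q : ℕ) {n : ℕ} (D S : ℕ) (f : (Fin n → Bool) → Bool) : Prop :=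
  (∃ i, f = fun x => x i) ∨ ∃ c : ACCircuit q n, c.Computes f ∧ c.depth ≤ D ∧ c.size ≤ S

section

variable {q n D S : ℕ}

theorem IsWire.mono {f : (Fin n → Bool) → Bool} {D' S' : ℕ} (h : IsWire q D S f) (hD : D ≤ D')
    (hS : S ≤ S') : IsWire q D' S' f := by
  rcases h with h | ⟨c, h1, h2, h3⟩
  · exact Or.inl h
  · exact Or.inr ⟨c, h1, h2.trans hD, h3.trans hS⟩

/-- A new gate may be put on top of wires `f i`, listed with repetitions by `L`. -/
theorem exists_gate {op : GateOp} (hop : op ≠ GateOp.not) {ι : Type} [Fintype ι]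
    {f : ι → (Fin n → Bool) → Bool} (hS : 1 ≤ S) (hf : ∀ i, IsWire q D S (f i)) (L : List ι) :
    ∃ c : ACCircuit q n, c.Computes (fun x => op.apply q (L.map fun i => f i x)) ∧
      c.depth ≤ D + 1 ∧ c.size ≤ 1 + L.length + Fintype.card ι * S ∧ c.op c.output = op := by
  classical
  -- The circuit chosen for an input variable is a dummy that no wire leaves.
  have hc : ∀ i, ∃ (c : ACCircuit q n) (w : Fin n ⊕ ι), c.size ≤ S ∧
      (∀ j, w = Sum.inr j → j = i ∧ c.depth ≤ D) ∧
      ∀ x, (w.elim x fun _ => c.value x c.output) = f i x := by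
    intro i
    rcases hf i with ⟨k, hk⟩ | ⟨c, h1, h2, h3⟩
    · refine ⟨ACCircuit.stack (ι := Empty) .and (by decide) Empty.rec [], Sum.inl k, ?_, by simp,
        by simp [hk]⟩
      rw [ACCircuit.size_stack]
      simpa using hS
    · exact ⟨c, Sum.inr i, h3, by rintro j ⟨⟩; exact ⟨rfl, h2⟩, h1⟩
  choose c w hcS hcD hcv using hc
  refine ⟨ACCircuit.stack op hop c (L.map w), fun x => ?_, ?_, ?_, rfl⟩
  · rw [ACCircuit.value_stack_output, List.map_map]
    congr 1
    refine List.map_congr_left fun i _ => ?_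
    rw [Function.comp_apply, ← hcv i x]
    rcases hw : w i with k | k
    · rfl
    · rw [(hcD i k hw).1]
      rfl
  · refine ACCircuit.depth_stack_le _ _ _ fun i hi => ?_
    obtain ⟨j, _, hj⟩ := List.mem_map.1 hi
    obtain ⟨rfl, h⟩ := hcD j i hj
    exact h
  · rw [ACCircuit.size_stack, List.length_map]
    refine Nat.add_le_add_left ?_ _
    exact (Finset.sum_le_card_nsmul _ _ S fun i _ => hcS i).trans_eq (by simp)

/-- `f` is a wire or constantly false. The constant `false` needs a gate, unlike an input variable,
but a conjunction that contains it is an empty OR gate, so it is a literal already at depth `0`. -/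
def IsLiteral (q : ℕ) {n : ℕ} (D S : ℕ) (f : (Fin n → Bool) → Bool) : Prop :=
  (f = fun _ => false) ∨ IsWire q D S f

/-- The conjunction of literals of depth `D` is a wire of depth `D + 1`; if one of the literals is
constantly false, then the conjunction is an empty OR gate. -/
theorem isWire_all (hS : 1 ≤ S) {b : ℕ} {l : List ((Fin n → Bool) → Bool)} (hb : l.length ≤ b)
    (hl : ∀ f ∈ l, IsLiteral q D S f) :
    IsWire q (D + 1) (1 + b + b * S) (fun x => l.all fun f => f x) := by
  by_cases h : (fun _ => false) ∈ l
  · obtain ⟨c, h1, h2, h3, -⟩ := exists_gate (q := q) (n := n) (D := D) (S := S) (op := .or)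
      (by decide) (ι := Empty) (f := Empty.rec) hS Empty.rec []
    refine Or.inr ⟨c, fun x => ?_, h2, h3.trans ?_⟩
    · have : (l.all fun f => f x) = false := List.all_eq_false.2 ⟨_, h, by simp⟩
      exact (h1 x).trans this.symm
    · simp [add_assoc]
  · obtain ⟨c, h1, h2, h3, -⟩ := exists_gate (q := q) (op := .and) (by decide)
      (f := l.get) hS (fun i => (hl _ (l.get_mem i)).resolve_left
        fun e => h (e ▸ l.get_mem i)) (List.finRange l.length)
    refine Or.inr ⟨c, fun x => ?_, h2, h3.trans ?_⟩
    · rw [h1 x]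
      have : ((List.finRange l.length).map fun i => l.get i x) = l.map fun f => f x := by
        conv_rhs => rw [← List.map_get_finRange l, List.map_map]
        rfl
      simp only [this, GateOp.apply, List.all_map]
      rfl
    · rw [List.length_finRange, Fintype.card_fin]
      gcongr

/-- A `MOD` gate whose `t`-th input wire is repeated `μ t` times. -/
theorem exists_mod_gate (hS : 1 ≤ S) {T : Type} [Fintype T] {f : T → (Fin n → Bool) → Bool}
    (hf : ∀ t, IsWire q D S (f t)) {M : ℕ} (μ : T → ℕ) (hμ : ∀ t, μ t ≤ M) :
    IsWire q (D + 1) (1 + Fintype.card T * (M + S))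
      (fun x => decide (q ∣ ∑ t, if f t x then μ t else 0)) := by
  obtain ⟨c, h1, h2, h3, -⟩ := exists_gate (q := q) (op := .mod) (by decide) hS hf
    ((Finset.univ : Finset T).toList.flatMap fun t => List.replicate (μ t) t)
  refine Or.inr ⟨c, fun x => ?_, h2, h3.trans ?_⟩
  · rw [h1 x]
    simp only [GateOp.apply]
    congr 2
    rw [List.map_flatMap, List.count_flatMap, ← Finset.sum_map_toList]
    congr 1
    refine List.map_congr_left fun t _ => ?_
    cases h : f t x <;> simp [h, List.count_replicate]
  · rw [List.length_flatMap]
    simp only [List.length_replicate]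
    rw [Finset.sum_map_toList]
    have : ∑ t, μ t ≤ Fintype.card T * M :=
      (Finset.sum_le_card_nsmul _ _ M fun i _ => hμ i).trans_eq (by simp)
    rw [mul_add]
    omega

end

/-! ### Polynomials over `ZMod p` in wires -/

section

variable {q n D S : ℕ} {p : ℕ}

/-- `F` is a polynomial over `ZMod p` with at most `τ` terms of degree at most `b` in Boolean
functions that are literals of depth `D` and size `S`. A monomial is the list `l t` of its factors,
whose product is their conjunction. -/
def IsSparsePoly (q : ℕ) {n p : ℕ} (D S b τ : ℕ) (F : (Fin n → Bool) → ZMod p) : Prop :=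
  ∃ (T : Type) (_ : Fintype T) (a : T → ZMod p) (l : T → List ((Fin n → Bool) → Bool)),
    Fintype.card T ≤ τ ∧ (∀ t, (l t).length ≤ b) ∧ (∀ t, ∀ f ∈ l t, IsLiteral q D S f) ∧
      ∀ x, F x = ∑ t, if (l t).all (fun f => f x) then a t else 0

theorem IsSparsePoly.const (a : ZMod p) : IsSparsePoly q (n := n) D S 0 1 (fun _ => a) :=
  ⟨Unit, inferInstance, fun _ => a, fun _ => [], by simp, by simp, by simp, by simp⟩

theorem IsSparsePoly.mul {b b' τ τ' : ℕ} {F F' : (Fin n → Bool) → ZMod p}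
    (h : IsSparsePoly q D S b τ F) (h' : IsSparsePoly q D S b' τ' F') :
    IsSparsePoly q D S (b + b') (τ * τ') (fun x => F x * F' x) := by
  obtain ⟨T, _, a, l, h1, h2, h3, h4⟩ := h
  obtain ⟨T', _, a', l', h1', h2', h3', h4'⟩ := h'
  refine ⟨T × T', inferInstance, fun t => a t.1 * a' t.2, fun t => l t.1 ++ l' t.2, ?_, ?_, ?_, ?_⟩
  · rw [Fintype.card_prod]
    gcongr
  · intro t
    rw [List.length_append]
    exact add_le_add (h2 _) (h2' _)
  · intro t f hf
    exact (List.mem_append.1 hf).elim (h3 _ f) (h3' _ f)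
  · intro x
    simp only [h4, h4']
    rw [Finset.sum_mul_sum, Fintype.sum_prod_type]
    refine Finset.sum_congr rfl fun t _ => Finset.sum_congr rfl fun t' _ => ?_
    rw [List.all_append]
    cases (l t).all (fun f => f x) <;> cases (l' t').all (fun f => f x) <;> simp

theorem IsSparsePoly.sum {κ : Type} [Fintype κ] {b τ : ℕ} {F : κ → (Fin n → Bool) → ZMod p}
    (h : ∀ k, IsSparsePoly q D S b τ (F k)) :
    IsSparsePoly q D S b (Fintype.card κ * τ) (fun x => ∑ k, F k x) := by
  choose T _ a l h1 h2 h3 h4 using h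
  refine ⟨Σ k, T k, inferInstance, fun t => a t.1 t.2, fun t => l t.1 t.2, ?_, fun t => h2 _ _,
    fun t => h3 _ _, fun x => ?_⟩
  · rw [Fintype.card_sigma]
    exact (Finset.sum_le_card_nsmul _ _ τ fun k _ => h1 k).trans_eq (by simp)
  · rw [Fintype.sum_sigma]
    exact Finset.sum_congr rfl fun k _ => h4 k x

/-- Whether a polynomial takes the value `w` is decided by a `MOD_q` gate over AND gates. Wires are
repeated according to the coefficients, and `q / p` times more often in order to count modulo `p`
only. -/
theorem IsSparsePoly.isWire_eq [NeZero p] (hq : 0 < q) (hpq : p ∣ q) (hS : 1 ≤ S) {b τ : ℕ}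
    {F : (Fin n → Bool) → ZMod p} (h : IsSparsePoly q D S b τ F) (w : ZMod p) :
    IsWire q (D + 2) (1 + (τ + 1) * (q + (1 + b + b * S))) (fun x => decide (F x = w)) := by
  obtain ⟨T, _, a, l, h1, h2, h3, h4⟩ := h
  obtain ⟨m, rfl⟩ := hpq
  have hm : 0 < m := Nat.pos_of_mul_pos_left hq
  -- The empty list is the constant term, which carries the coefficient `-w`.
  let l' : Option T → List ((Fin n → Bool) → Bool) := fun t => t.elim [] l
  let a' : Option T → ZMod p := fun t => t.elim (-w) a
  have hl' : ∀ t, IsWire (p * m) (D + 1) (1 + b + b * S) (fun x => (l' t).all fun f => f x) := by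
    rintro (_ | t)
    · exact isWire_all hS (Nat.zero_le b) (by simp [l'])
    · exact isWire_all hS (h2 t) (h3 t)
  have key := exists_mod_gate (by omega) hl' (M := p * m) (fun t => m * (a' t).val)
    (fun t => by rw [mul_comm]; exact Nat.mul_le_mul_right m (ZMod.val_lt _).le)
  refine (?_ : (fun x => decide (F x = w)) = _) ▸ key.mono le_rfl ?_
  · funext x
    have e : (∑ t, if (l' t).all (fun f => f x) then m * (a' t).val else 0) =
        m * ∑ t, if (l' t).all (fun f => f x) then (a' t).val else 0 := by
      simp only [Finset.mul_sum, mul_ite, mul_zero]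
    have e' : ((∑ t, if (l' t).all (fun f => f x) then (a' t).val else 0 : ℕ) : ZMod p) =
        -w + F x := by
      rw [Nat.cast_sum, Fintype.sum_option, h4]
      congr 1
      · simp [l', a']
      · refine Finset.sum_congr rfl fun t _ => ?_
        change ((if (l t).all (fun f => f x) then (a t).val else 0 : ℕ) : ZMod p) = _
        split_ifs <;> simp
    simp only [e]
    rw [decide_eq_decide, mul_comm p m, Nat.mul_dvd_mul_iff_left hm,
      ← ZMod.natCast_eq_zero_iff, e', neg_add_eq_zero, eq_comm]
  · rw [Fintype.card_option]
    gcongr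

/-- `F` has values in `ZMod p`, and the indicators of its nonzero values are literals. The value `0`
is left out because the negation of an input variable is not a literal. -/
def IsResidue (q : ℕ) {n p : ℕ} (D S : ℕ) (F : (Fin n → Bool) → ZMod p) : Prop :=
  ∀ v ≠ 0, IsLiteral q D S (fun x => decide (F x = v))

theorem IsResidue.isSparsePoly [NeZero p] {F : (Fin n → Bool) → ZMod p} (h : IsResidue q D S F) :
    IsSparsePoly q D S 1 p F := by
  classical
  refine ⟨{v : ZMod p // v ≠ 0}, inferInstance, fun v => v, fun v => [fun x => decide (F x = v)],
    (Fintype.card_subtype_le _).trans_eq (ZMod.card p), by simp, ?_, fun x => ?_⟩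
  · intro v f hf
    rw [List.mem_singleton.1 hf]
    exact h v v.2
  · simp only [List.all_cons, List.all_nil, Bool.and_true, decide_eq_true_eq]
    by_cases hx : F x = 0
    · rw [hx, Finset.sum_eq_zero]
      intro v _
      rw [if_neg (Ne.symm v.2)]
    · rw [Finset.sum_eq_single ⟨F x, hx⟩]
      · simp
      · intro v _ hv
        rw [if_neg]
        rintro e
        exact hv (Subtype.ext e.symm)
      · simp

theorem isSparsePoly_pow [NeZero p] {κ : Type} [Fintype κ] [DecidableEq κ]
    {A : (Fin n → Bool) → Matrix κ κ (ZMod p)}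
    (h : ∀ i j, IsResidue q D S (fun x => A x i j)) (b : ℕ) (i j : κ) :
    IsSparsePoly q D S b ((Fintype.card κ * p) ^ b) (fun x => (A x ^ b) i j) := by
  induction b generalizing j with
  | zero =>
    simp only [pow_zero]
    exact IsSparsePoly.const _
  | succ b ih =>
    simp only [pow_succ _ b, Matrix.mul_apply]
    convert IsSparsePoly.sum (fun k => (ih k).mul (h k j).isSparsePoly) using 1
    ring

theorem term_count_bound {N p b τ S : ℕ} (hN : 1 ≤ N) (hp : p ≤ 7) (hS : 1 ≤ S)
    (hτ : τ ≤ N * (N * p) ^ b) :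
    1 + (τ + 1) * (42 + (1 + b + b * S)) ≤ (92 * N) ^ (b + 1) * S := by
  have h1 : τ + 1 ≤ 2 * (N * (N * 7) ^ b) := by
    have : N * (N * p) ^ b ≤ N * (N * 7) ^ b := by gcongr
    have : 0 < N * (N * 7) ^ b := by positivity
    omega
  have h2 : b + 1 ≤ 2 ^ b := Nat.lt_two_pow_self
  have h3 : 42 + (1 + b + b * S) ≤ 44 * ((b + 1) * S) := by nlinarith
  calc 1 + (τ + 1) * (42 + (1 + b + b * S))
      ≤ 1 + 2 * (N * (N * 7) ^ b) * (44 * (2 ^ b * S)) := by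
        gcongr
        exact h3.trans (by gcongr)
    _ = 1 + 88 * N * (14 * N) ^ b * S := by
        rw [show 14 * N = N * 7 * 2 by ring, mul_pow _ 2]
        ring
    _ ≤ 92 * N * (14 * N) ^ b * S := by
        have : 0 < N * (14 * N) ^ b * S := by positivity
        nlinarith
    _ ≤ 92 * N * (92 * N) ^ b * S := by gcongr; norm_num
    _ = _ := by ring

/-- Computing the entries of `A ^ (p ^ j)` with two layers of gates for every factor `p ^ r`. -/
theorem isResidue_pow_pow [NeZero p] (hp7 : p ≤ 7) (hp : p ∣ 42) {κ : Type} [Fintype κ] [Nonempty κ]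
    [DecidableEq κ] {A : (Fin n → Bool) → Matrix κ κ (ZMod p)}
    (h : ∀ i j, IsResidue 42 0 1 (fun x => A x i j)) (r l j : ℕ) (hj : j ≤ l * r) (i k : κ) :
    IsResidue 42 (2 * l) ((92 * Fintype.card κ) ^ ((p ^ r + 1) * l))
      (fun x => (A x ^ p ^ j) i k) := by
  induction l generalizing j i k with
  | zero =>
    obtain rfl : j = 0 := by omega
    simpa using h i k
  | succ l ih =>
    have hκ : 1 ≤ Fintype.card κ := Fintype.card_pos
    have e : ∀ x, A x ^ p ^ j = (A x ^ p ^ (j - r)) ^ p ^ min j r := fun x => by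
      rw [← pow_mul, ← pow_add]
      congr 2
      omega
    simp only [e]
    intro v _
    have hS : 1 ≤ (92 * Fintype.card κ) ^ ((p ^ r + 1) * l) := Nat.one_le_pow _ _ (by omega)
    refine Or.inr (((isSparsePoly_pow (ih (j - r) (by rw [add_one_mul] at hj; omega)) (p ^ min j r) i
      k).isWire_eq (by norm_num) hp hS v).mono (by omega) ?_)
    refine (term_count_bound hκ hp7 hS (Nat.le_mul_of_pos_left _ hκ)).trans ?_
    rw [← pow_add, mul_add_one, add_comm]
    have : p ^ min j r ≤ p ^ r := Nat.pow_le_pow_right (NeZero.pos p) (min_le_right _ _)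
    exact Nat.pow_le_pow_right (by omega) (by omega)

/-- Summing a row of `A ^ (p ^ j)` in the last `MOD` layer takes no additional depth. -/
theorem isWire_row_sum [NeZero p] (hp7 : p ≤ 7) (hp : p ∣ 42) {κ : Type} [Fintype κ] [Nonempty κ]
    [DecidableEq κ] {A : (Fin n → Bool) → Matrix κ κ (ZMod p)}
    (h : ∀ i j, IsResidue 42 0 1 (fun x => A x i j)) (r l j : ℕ) (hj : j ≤ (l + 1) * r) (i : κ) :
    IsWire 42 (2 * (l + 1)) ((92 * Fintype.card κ) ^ ((p ^ r + 1) * (l + 1)))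
      (fun x => decide (∑ k, (A x ^ p ^ j) i k = 0)) := by
  have hκ : 1 ≤ Fintype.card κ := Fintype.card_pos
  have e : ∀ x, A x ^ p ^ j = (A x ^ p ^ (j - r)) ^ p ^ min j r := fun x => by
    rw [← pow_mul, ← pow_add]
    congr 2
    omega
  simp only [e]
  have hS : 1 ≤ (92 * Fintype.card κ) ^ ((p ^ r + 1) * l) := Nat.one_le_pow _ _ (by omega)
  refine ((IsSparsePoly.sum fun k => isSparsePoly_pow (isResidue_pow_pow hp7 hp h r l (j - r)
    (by rw [add_one_mul] at hj; omega)) (p ^ min j r) i k).isWire_eq (by norm_num) hp hS 0).mono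
    (by omega) ?_
  refine (term_count_bound hκ hp7 hS le_rfl).trans ?_
  rw [← pow_add, mul_add_one, add_comm]
  have : p ^ min j r ≤ p ^ r := Nat.pow_le_pow_right (NeZero.pos p) (min_le_right _ _)
  exact Nat.pow_le_pow_right (by omega) (by omega)

end

/-! ### Divisibility by prime powers through binomial coefficients -/

/-- The case of Lucas' theorem that extracts the `j`-th digit of `N` in base `p`. -/
theorem choose_prime_pow_modEq {p : ℕ} [Fact p.Prime] (N j : ℕ) :
    N.choose (p ^ j) ≡ N / p ^ j [MOD p] := by
  induction j generalizing N with
  | zero => simp [Nat.ModEq]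
  | succ j ih =>
    have hp : 0 < p := (Fact.out : p.Prime).pos
    have h := Choose.choose_modEq_choose_mod_mul_choose_div_nat (p := p) (n := N) (k := p ^ (j + 1))
    have e1 : p ^ (j + 1) % p = 0 := Nat.mod_eq_zero_of_dvd (dvd_pow_self p (by omega))
    have e2 : p ^ (j + 1) / p = p ^ j := by rw [pow_succ, Nat.mul_div_cancel _ hp]
    rw [e1, e2, Nat.choose_zero_right, one_mul] at h
    refine (h.trans (ih (N / p))).trans ?_
    rw [Nat.div_div_eq_div_mul, pow_succ']

theorem prime_pow_dvd_iff_choose {p : ℕ} [Fact p.Prime] (N s : ℕ) :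
    p ^ s ∣ N ↔ ∀ j < s, p ∣ N.choose (p ^ j) := by
  have hp : 0 < p := (Fact.out : p.Prime).pos
  induction s with
  | zero => simp
  | succ s ih =>
    refine Iff.trans ?_ (Nat.forall_lt_succ_right.trans (and_congr_left' ih.symm)).symm
    rw [(choose_prime_pow_modEq N s).dvd_iff dvd_rfl]
    constructor
    · intro h
      refine ⟨(pow_dvd_pow p (Nat.le_succ s)).trans h, ?_⟩
      obtain ⟨c, rfl⟩ := h
      rw [pow_succ, mul_assoc, Nat.mul_div_cancel_left _ (by positivity)]
      exact dvd_mul_right _ _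
    · rintro ⟨⟨c, rfl⟩, h⟩
      rw [Nat.mul_div_cancel_left _ (by positivity)] at h
      rw [pow_succ]
      exact Nat.mul_dvd_mul_left _ h

/-! ### Elementary symmetric polynomials as matrix powers -/

/-- The entry at `i < k` is the `k`-th input bit, counted from `1`, and the other entries vanish.
The entry of its `D`-th power at `(i, k)` counts the `D`-subsets of the ones in the interval
`(i, k]` that contain `k`. -/
def stepMatrix (R : Type) [Semiring R] {n : ℕ} (x : Fin n → Bool) :
    Matrix (Fin (n + 1)) (Fin (n + 1)) R :=
  fun i k => Fin.cases 0 (fun a => if i ≤ a.castSucc ∧ x a = true then 1 else 0) k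

/-- The number of ones at the positions `≥ i`. -/
def tailCount {n : ℕ} (x : Fin n → Bool) (i : ℕ) : ℕ :=
  (Finset.univ.filter fun a : Fin n => i ≤ a ∧ x a = true).card

theorem tailCount_zero {n : ℕ} (x : Fin n → Bool) :
    tailCount x 0 = (Finset.univ.filter fun a => x a = true).card := by
  simp [tailCount]

theorem tailCount_eq {n : ℕ} (x : Fin n → Bool) (a : Fin n) :
    tailCount x a = (if x a then 1 else 0) + tailCount x (a + 1) := by
  unfold tailCount
  have : (Finset.univ.filter fun b : Fin n => (a : ℕ) ≤ b ∧ x b = true) =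
      (Finset.univ.filter fun b : Fin n => b = a ∧ x b = true) ∪
      (Finset.univ.filter fun b : Fin n => (a : ℕ) + 1 ≤ b ∧ x b = true) := by
    ext b
    simp only [Finset.mem_filter, Finset.mem_union, Finset.mem_univ, true_and, Fin.ext_iff]
    rw [← or_and_right]
    exact and_congr_left' (by omega)
  rw [this, Finset.card_union_of_disjoint]
  · congr 1
    split_ifs with h
    · rw [Finset.card_eq_one]
      refine ⟨a, ?_⟩
      ext b
      simp only [Finset.mem_filter, Finset.mem_univ, true_and, Finset.mem_singleton]
      exact ⟨And.left, fun e => ⟨e, e ▸ h⟩⟩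
    · rw [Finset.card_eq_zero, Finset.filter_eq_empty_iff]
      rintro b - ⟨rfl, hb⟩
      exact h hb
  · rw [Finset.disjoint_filter]
    rintro b - ⟨rfl, -⟩ ⟨h, -⟩
    omega

theorem tailCount_of_le {n : ℕ} (x : Fin n → Bool) {i : ℕ} (h : n ≤ i) : tailCount x i = 0 := by
  rw [tailCount, Finset.card_eq_zero, Finset.filter_eq_empty_iff]
  rintro a - ⟨ha, -⟩
  omega

/-- Sorting the `(D + 1)`-subsets of the ones by their least element. -/
theorem sum_choose_tailCount {n : ℕ} (x : Fin n → Bool) (D i : ℕ) :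
    (∑ a : Fin n, if i ≤ a ∧ x a = true then (tailCount x (a + 1)).choose D else 0) =
      (tailCount x i).choose (D + 1) := by
  rcases le_total n i with h | h
  · rw [tailCount_of_le x h, Finset.sum_eq_zero]
    · rfl
    · intro a _
      rw [if_neg]
      rintro ⟨ha, -⟩
      omega
  · induction h using Nat.decreasingInduction with
    | self =>
      rw [tailCount_of_le x le_rfl, Finset.sum_eq_zero]
      · rfl
      · intro a _
        rw [if_neg]
        rintro ⟨ha, -⟩
        omega
    | of_succ i hi ih =>
      have e : ∀ a : Fin n,
          (if i ≤ a ∧ x a = true then (tailCount x (a + 1)).choose D else 0) =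
          (if a = ⟨i, hi⟩ then (if x ⟨i, hi⟩ then (tailCount x (i + 1)).choose D else 0) else 0) +
          (if i + 1 ≤ a ∧ x a = true then (tailCount x (a + 1)).choose D else 0) := by
        intro a
        by_cases ha : a = ⟨i, hi⟩
        · subst ha
          simp
        · have : (i ≤ (a : ℕ)) ↔ (i + 1 ≤ (a : ℕ)) := by
            have : (a : ℕ) ≠ i := fun h => ha (Fin.ext h)
            omega
          rw [if_neg ha, zero_add]
          simp only [this]
      rw [Finset.sum_congr rfl fun a _ => e a, Finset.sum_add_distrib, ih, Finset.sum_ite_eq']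
      have := tailCount_eq x ⟨i, hi⟩
      simp only at this
      rw [this, if_pos (Finset.mem_univ _)]
      split_ifs
      · rw [add_comm 1, Nat.choose_succ_succ]
      · simp

theorem sum_stepMatrix_pow (R : Type) [Semiring R] {n : ℕ} (x : Fin n → Bool) (D : ℕ)
    (i : Fin (n + 1)) :
    ∑ k, (stepMatrix R x ^ D) i k = ((tailCount x i).choose D : R) := by
  induction D generalizing i with
  | zero => simp [Matrix.one_apply]
  | succ D ih =>
    simp only [pow_succ', Matrix.mul_apply]
    rw [Finset.sum_comm]
    simp only [← Finset.mul_sum, ih]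
    rw [Fin.sum_univ_succ, ← sum_choose_tailCount x D i, Nat.cast_sum]
    simp only [stepMatrix, Fin.cases_zero, Fin.cases_succ, zero_mul, zero_add, ite_mul, one_mul,
      Fin.val_succ, Nat.cast_ite, Nat.cast_zero]
    rfl

theorem isResidue_stepMatrix {p n : ℕ} [Fact p.Prime] (q : ℕ) (i k : Fin (n + 1)) :
    IsResidue q 0 1 (fun x : Fin n → Bool => stepMatrix (ZMod p) x i k) := by
  intro v hv
  refine Fin.cases (Or.inl ?_) (fun a => ?_) k
  · funext x
    exact decide_eq_false (by simpa [stepMatrix] using hv.symm)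
  · by_cases h : i ≤ a.castSucc ∧ v = 1
    · refine Or.inr (Or.inl ⟨a, ?_⟩)
      funext x
      cases hx : x a <;> simp [stepMatrix, h.1, h.2, hx]
    · refine Or.inl ?_
      funext x
      rw [not_and_or] at h
      refine decide_eq_false ?_
      simp only [stepMatrix, Fin.cases_succ]
      split_ifs with hx
      · exact fun e : 1 = v => h.elim (fun h => h hx.1) fun h => h e.symm
      · exact hv.symm

/-- Divisibility of `C(N, p ^ j)` by `p`, where `N` is the number of ones of the input. -/
theorem isWire_dvd_choose {p n : ℕ} [Fact p.Prime] (hp7 : p ≤ 7) (hp : p ∣ 42) (r l j : ℕ)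
    (hj : j ≤ (l + 1) * r) :
    IsWire 42 (2 * (l + 1)) ((92 * (n + 1)) ^ ((p ^ r + 1) * (l + 1)))
      (fun x : Fin n → Bool =>
        decide (p ∣ (Finset.univ.filter fun a => x a = true).card.choose (p ^ j))) := by
  have h := isWire_row_sum hp7 hp (isResidue_stepMatrix (p := p) (n := n) 42) r l j hj 0
  rw [Fintype.card_fin] at h
  simp only [sum_stepMatrix_pow, Fin.val_zero, tailCount_zero, ZMod.natCast_eq_zero_iff] at h
  exact h

/-! ### Choice of parameters -/

/-- The AND of these wires over `j < s` computes `MOD_{p ^ s}`. The exponent `j < s` is split into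
`min e s` parts of at most `r = (s - 1) / e + 1`: the bound by `e` keeps the depth, and the bound by
`s` keeps the size independent of `e`. Since `s - 1 < β * logb p n`, the fan-in parameter `p ^ r` is
at most `p * n ^ (β / e)`. -/
theorem exists_isWire_dvd_choose {p : ℕ} [Fact p.Prime] (hp7 : p ≤ 7) (hp : p ∣ 42) {n e s : ℕ}
    {β X : ℝ} (hn : 1 ≤ n) (he : 1 ≤ e) (hβ0 : 0 ≤ β) (hβ1 : β ≤ 1)
    (hX : (n : ℝ) ^ (β / e) ≤ X) (hs : s = ⌈β * Real.logb p n⌉₊) :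
    ∃ B : ℕ, (B : ℝ) ≤ 16 * X * Real.logb 2 (n + 1) ∧ (s : ℝ) ≤ 2 * Real.logb 2 (n + 1) ∧
      ∀ j < s, IsWire 42 (2 * e) ((92 * (n + 1)) ^ B) (fun x : Fin n → Bool =>
        decide (p ∣ (Finset.univ.filter fun a => x a = true).card.choose (p ^ j))) := by
  have hp2 : 2 ≤ p := (Fact.out : p.Prime).two_le
  have hp2' : (2 : ℝ) ≤ p := by exact_mod_cast hp2
  have hp1 : (1 : ℝ) < p := by linarith
  have hp0 : (0 : ℝ) < p := by linarith
  have hn' : (1 : ℝ) ≤ n := by exact_mod_cast hn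
  have hlogp : 0 ≤ Real.logb p n := Real.logb_nonneg hp1 hn'
  have hL : 1 ≤ Real.logb 2 ((n : ℝ) + 1) := by
    rw [Real.le_logb_iff_rpow_le (by norm_num) (by linarith)]
    norm_num
    linarith
  have hlog : β * Real.logb p n ≤ Real.logb 2 ((n : ℝ) + 1) := by
    have h1 : Real.logb p n ≤ Real.logb 2 n := by
      unfold Real.logb
      exact div_le_div_of_nonneg_left (Real.log_nonneg hn') (Real.log_pos (by norm_num))
        (Real.log_le_log (by norm_num) hp2')
    have h2 : Real.logb 2 n ≤ Real.logb 2 ((n : ℝ) + 1) :=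
      Real.logb_le_logb_of_le (by norm_num) (by linarith) (by linarith)
    nlinarith
  have hX1 : 1 ≤ X := (Real.one_le_rpow hn' (by positivity)).trans hX
  have hs1 : (s : ℝ) < β * Real.logb p n + 1 := by
    rw [hs]
    exact Nat.ceil_lt_add_one (mul_nonneg hβ0 hlogp)
  have hs2 : (s : ℝ) ≤ 2 * Real.logb 2 ((n : ℝ) + 1) := by linarith
  rcases Nat.eq_zero_or_pos s with h0 | h0
  · refine ⟨0, ?_, hs2, fun j hj => by omega⟩
    rw [Nat.cast_zero]
    positivity
  obtain ⟨l, hl⟩ : ∃ l, min e s = l + 1 := ⟨min e s - 1, by omega⟩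
  refine ⟨(p ^ ((s - 1) / e + 1) + 1) * (l + 1), ?_, hs2, fun j hj => ?_⟩
  · have h1 : (p : ℝ) ^ ((s - 1) / e) ≤ X := by
      refine le_trans ?_ hX
      rw [← Real.rpow_natCast]
      calc (p : ℝ) ^ (((s - 1) / e : ℕ) : ℝ) ≤ (p : ℝ) ^ (Real.logb p n * (β / e)) := by
            refine Real.rpow_le_rpow_of_exponent_le hp1.le (Nat.cast_div_le.trans ?_)
            rw [mul_div_assoc', Nat.cast_sub h0, Nat.cast_one]
            gcongr
            linarith
        _ = (n : ℝ) ^ (β / e) := by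
            rw [Real.rpow_mul hp0.le, Real.rpow_logb hp0 hp1.ne' (by linarith)]
    have h2 : (p : ℝ) ≤ 7 := by exact_mod_cast hp7
    have h3 : ((l + 1 : ℕ) : ℝ) ≤ s := by
      rw [← hl]
      exact_mod_cast min_le_right _ _
    have h4 : (p : ℝ) ^ ((s - 1) / e + 1) ≤ X * 7 := by
      rw [pow_succ]
      gcongr
    rw [Nat.cast_mul, Nat.cast_add, Nat.cast_pow, Nat.cast_one]
    calc ((p : ℝ) ^ ((s - 1) / e + 1) + 1) * ((l + 1 : ℕ) : ℝ)
        ≤ (8 * X) * (2 * Real.logb 2 ((n : ℝ) + 1)) := by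
          gcongr
          · linarith
          · linarith
      _ = _ := by ring
  · refine (isWire_dvd_choose hp7 hp ((s - 1) / e + 1) l j ?_).mono (by omega) le_rfl
    rw [← hl]
    rcases le_total e s with h | h
    · rw [min_eq_left h]
      have := Nat.lt_mul_div_succ (s - 1) (show 0 < e by omega)
      omega
    · rw [min_eq_right h]
      exact hj.le.trans (Nat.le_mul_of_pos_right _ (Nat.succ_pos _))

/-- An AND gate over three families of wires, of depth `D + 1`. -/
theorem exists_and_gate {n D S s t u : ℕ} (hS : 1 ≤ S) {f g h : ℕ → (Fin n → Bool) → Bool}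
    (hf : ∀ j < s, IsWire 42 D S (f j)) (hg : ∀ j < t, IsWire 42 D S (g j))
    (hh : ∀ j < u, IsWire 42 D S (h j)) :
    ∃ c : ACCircuit 42 n,
      (∀ x, c.value x c.output = true ↔
        (∀ j < s, f j x = true) ∧ (∀ j < t, g j x = true) ∧ ∀ j < u, h j x = true) ∧
      c.depth ≤ D + 1 ∧ c.size ≤ 1 + (s + t + u) * (S + 1) ∧ c.op c.output = GateOp.and := by
  obtain ⟨c, h1, h2, h3, h4⟩ := exists_gate (q := 42) (op := .and) (by decide)
    (ι := Fin s ⊕ Fin t ⊕ Fin u)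
    (f := Sum.elim (fun j => f j) (Sum.elim (fun j => g j) fun j => h j)) (D := D) hS
    (by
      rintro (j | j | j)
      · exact hf j j.2
      · exact hg j j.2
      · exact hh j j.2) Finset.univ.toList
  refine ⟨c, fun x => ?_, h2, h3.trans_eq ?_, h4⟩
  · rw [h1 x]
    simp [GateOp.apply, Fin.forall_iff]
  · simp only [Finset.length_toList, Finset.card_univ, Fintype.card_sum, Fintype.card_fin]
    ring

theorem modFunction_eq_true_iff {n s t u : ℕ} (x : Fin n → Bool) :
    modFunction (2 ^ s * 3 ^ t * 7 ^ u) n x = true ↔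
      2 ^ s ∣ (Finset.univ.filter fun i => x i = true).card ∧
      3 ^ t ∣ (Finset.univ.filter fun i => x i = true).card ∧
      7 ^ u ∣ (Finset.univ.filter fun i => x i = true).card := by
  have h1 : Nat.Coprime (2 ^ s) (3 ^ t) := Nat.Coprime.pow _ _ (by norm_num)
  have h2 : Nat.Coprime (2 ^ s * 3 ^ t) (7 ^ u) :=
    Nat.Coprime.mul_left (Nat.Coprime.pow _ _ (by norm_num)) (Nat.Coprime.pow _ _ (by norm_num))
  rw [modFunction, decide_eq_true_eq]
  constructor
  · intro h
    have h3 := dvd_of_mul_right_dvd h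
    exact ⟨dvd_of_mul_right_dvd h3, dvd_of_mul_left_dvd h3, dvd_of_mul_left_dvd h⟩
  · rintro ⟨h3, h4, h5⟩
    exact h2.mul_dvd_of_dvd_of_dvd (h1.mul_dvd_of_dvd_of_dvd h3 h4) h5

/-- The term `13 * L` is `≤ 2 ^ (4 + L)` and the base is `92 * (n + 1) ≤ 2 ^ (8 * L)`. -/
theorem size_bound {n B w : ℕ} {L X : ℝ} (hX : 1 ≤ X) (hL : 1 ≤ L) (hn : (2 : ℝ) ^ L = n + 1)
    (hB : (B : ℝ) ≤ 48 * X * L) (hw : (w : ℝ) ≤ 6 * L) :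
    ((1 + w * ((92 * (n + 1)) ^ B + 1) : ℕ) : ℝ) ≤ 2 ^ (389 * X * L ^ 2) := by
  have h2 : (1 : ℝ) ≤ 2 := by norm_num
  have hbase : (92 * ((n : ℝ) + 1)) ≤ 2 ^ (8 * L) := by
    calc (92 * ((n : ℝ) + 1)) ≤ 2 ^ (7 : ℝ) * 2 ^ L := by
          rw [hn]
          gcongr
          norm_num
      _ = 2 ^ (7 + L) := (Real.rpow_add (by norm_num) _ _).symm
      _ ≤ _ := Real.rpow_le_rpow_of_exponent_le h2 (by linarith)
  have hS : (92 * ((n : ℝ) + 1)) ^ B ≤ 2 ^ (384 * X * L ^ 2) := by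
    calc (92 * ((n : ℝ) + 1)) ^ B ≤ ((2 : ℝ) ^ (8 * L)) ^ B := by gcongr
      _ = 2 ^ (8 * L * B) := by rw [← Real.rpow_natCast, ← Real.rpow_mul (by norm_num)]
      _ ≤ _ := by
        refine Real.rpow_le_rpow_of_exponent_le h2 ?_
        calc 8 * L * B ≤ 8 * L * (48 * X * L) := by gcongr
          _ = _ := by ring
  have hS1 : (1 : ℝ) ≤ 2 ^ (384 * X * L ^ 2) := Real.one_le_rpow h2 (by positivity)
  have hLn : L ≤ 2 ^ L := by
    have := one_add_mul_self_le_rpow_one_add (s := 1) (by norm_num) hL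
    norm_num at this
    linarith
  calc ((1 + w * ((92 * (n + 1)) ^ B + 1) : ℕ) : ℝ)
      = 1 + w * ((92 * ((n : ℝ) + 1)) ^ B + 1) := by push_cast; ring
    _ ≤ 1 + 6 * L * (2 ^ (384 * X * L ^ 2) + 1) := by gcongr
    _ ≤ 16 * L * 2 ^ (384 * X * L ^ 2) := by nlinarith
    _ ≤ 2 ^ (4 : ℝ) * 2 ^ L * 2 ^ (384 * X * L ^ 2) := by
        gcongr
        norm_num
    _ = 2 ^ (4 + L + 384 * X * L ^ 2) := by
        rw [Real.rpow_add (by norm_num), Real.rpow_add (by norm_num)]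
    _ ≤ _ := by
        refine Real.rpow_le_rpow_of_exponent_le h2 ?_
        have h3 : L ≤ L ^ 2 := by nlinarith
        have h4 : L ^ 2 ≤ X * L ^ 2 := by nlinarith
        nlinarith

theorem theorem9 :
    ∃ (K : ℝ) (k : ℕ), ∀ (d n : ℕ) (α : ℝ) (s t u m : ℕ),
      0 < d → 6 ∣ d → 1 ≤ n → 0 < α → α ≤ 1 →
      s = ⌈3 * α * Real.logb 2 (n : ℝ) / 7⌉₊ →
      t = ⌈2 * α * Real.logb 3 (n : ℝ) / 7⌉₊ →
      u = ⌈2 * α * Real.logb 7 (n : ℝ) / 7⌉₊ →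
      m = 2 ^ s * 3 ^ t * 7 ^ u →
      ∃ c : ACCircuit 42 n,
        c.Computes (modFunction m n) ∧
        c.depth ≤ d + 1 ∧
        c.op c.output = GateOp.and ∧
        (c.size : ℝ) ≤
          (2 : ℝ) ^ (K * (n : ℝ) ^ (6 * α / (7 * (d : ℝ))) *
            Real.logb 2 ((n : ℝ) + 1) ^ k) := by
  refine ⟨389, 2, ?_⟩
  rintro d n α s t u m hd ⟨d', rfl⟩ hn hα hα1 hs ht hu rfl
  have hd' : 1 ≤ d' := by omega
  have hd'' : (0 : ℝ) < d' := by exact_mod_cast hd'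
  have hn' : (1 : ℝ) ≤ n := by exact_mod_cast hn
  set X : ℝ := (n : ℝ) ^ (6 * α / (7 * ((6 * d' : ℕ) : ℝ))) with hX
  set L : ℝ := Real.logb 2 ((n : ℝ) + 1) with hLdef
  have hL : 1 ≤ L := by
    rw [hLdef, Real.le_logb_iff_rpow_le (by norm_num) (by linarith)]
    norm_num
    linarith
  have hX1 : 1 ≤ X := Real.one_le_rpow hn' (by positivity)
  have : Fact (Nat.Prime 7) := ⟨by norm_num⟩
  -- Each prime is given all `2 * (3 * d')` layers; the prime `2` determines the exponent of `n`.
  have hX3 : (n : ℝ) ^ (3 * α / 7 / (3 * d' : ℕ)) ≤ X := by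
    refine Real.rpow_le_rpow_of_exponent_le hn' (le_of_eq ?_)
    push_cast
    field_simp
  have hX2 : (n : ℝ) ^ (2 * α / 7 / (3 * d' : ℕ)) ≤ X := by
    refine (Real.rpow_le_rpow_of_exponent_le hn' ?_).trans hX3
    gcongr
    norm_num
  obtain ⟨B₂, hB₂, hs', hf⟩ := exists_isWire_dvd_choose (p := 2) (by norm_num) (by norm_num) hn
    (show 1 ≤ 3 * d' by omega) (show 0 ≤ 3 * α / 7 by positivity) (by linarith) hX3
    (hs.trans (by push_cast; congr 1; ring))
  obtain ⟨B₃, hB₃, ht', hg⟩ := exists_isWire_dvd_choose (p := 3) (by norm_num) (by norm_num) hn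
    (show 1 ≤ 3 * d' by omega) (show 0 ≤ 2 * α / 7 by positivity) (by linarith) hX2
    (ht.trans (by push_cast; congr 1; ring))
  obtain ⟨B₇, hB₇, hu', hh⟩ := exists_isWire_dvd_choose (p := 7) (by norm_num) (by norm_num) hn
    (show 1 ≤ 3 * d' by omega) (show 0 ≤ 2 * α / 7 by positivity) (by linarith) hX2
    (hu.trans (by push_cast; congr 1; ring))
  have hmono : ∀ B ≤ B₂ + B₃ + B₇, (92 * (n + 1)) ^ B ≤ (92 * (n + 1)) ^ (B₂ + B₃ + B₇) :=
    fun B hB => Nat.pow_le_pow_right (by omega) hB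
  obtain ⟨c, h1, h2, h3, h4⟩ := exists_and_gate (S := (92 * (n + 1)) ^ (B₂ + B₃ + B₇))
    (Nat.one_le_pow _ _ (by omega))
    (fun j hj => (hf j hj).mono le_rfl (hmono _ (by omega)))
    (fun j hj => (hg j hj).mono le_rfl (hmono _ (by omega)))
    (fun j hj => (hh j hj).mono le_rfl (hmono _ (by omega)))
  refine ⟨c, fun x => ?_, by omega, h4, ?_⟩
  · rw [Bool.eq_iff_iff, h1, modFunction_eq_true_iff, prime_pow_dvd_iff_choose,
      prime_pow_dvd_iff_choose, prime_pow_dvd_iff_choose]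
    simp only [decide_eq_true_eq]
  · refine (Nat.cast_le.2 h3).trans (size_bound hX1 hL ?_ ?_ ?_)
    · exact Real.rpow_logb (by norm_num) (by norm_num) (by linarith)
    · push_cast
      linarith
    · push_cast
      linarith
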